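/- \textbf{Proposition ($\Omega(\sqrt N)$ lower bound).} \emph{Matrices.} Let $P$ be the ($N\times N$, row-stochastic) transition matrix of an ergodic Markov chain, i.e.\ every state is reachable from every state with positive probability in finitely many steps. Its symmetrised discriminant is $D_{ij}=\sqrt{P_{ij}P_{ji}}$. Let $\mathcal D_N$ be the set of symmetrised discriminants of ergodic $N$-state chains whose largest singular value is $1$, and $\mathcal T_N$ the set of transition matrices of ergodic $N$-state chains whose largest singular value is $1$. The singular gap of a matrix $A$ with singular values $\sigma_1\ge\sigma_2\ge\dots\ge\sigma_N$ is $\sigma_1-\sigma_2$, so it equals $1-\sigma_2$ on $\mathcal D_N$ and $\mathcal T_N$. \emph{Block encodings.} For unit vectors $|x_1\rangle,|x_2\rangle\in\mathbb C^d$ and $s>0$, a unitary $U$ on $\mathbb C^d\otimes\mathbb C^N$ is a block encoding of $A$ if $(\langle x_1|\otimes I)\,U\,(|x_2\rangle\otimes I)=\frac1s A$; it is unscaled if $s=1$. \emph{Algorithms.} An algorithm with $T$ uses of $U$ acts on $\mathbb C^d\otimes\mathbb C^N\otimes\mathbb C^w$, with a workspace of arbitrary finite dimension $w$. It starts in a fixed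 state, alternates $T$ uses of $U$ with fixed unitaries that do not depend on $U$, and finally measures in the computational basis to output ``greater'' or ``less''. A use applies $U$, $U^\dagger$ or the identity to the first two registers, the choice being controlled by the basis state of the workspace (so plain and controlled uses of $U$ and $U^\dagger$ are all included). \emph{Deciding.} Given $\Delta>0$, $0\le\varepsilon<1$ and $p$, the algorithm decides the singular gap on a set of matrices with error probability at most $p$ if, for every $A$ in the set and every block encoding $U$ of $A$ (for the given $x_1,x_2,s$), it outputs ``greater'' with probability at least $1-p$ whenever the singular gap of $A$ exceeds $(1+\varepsilon)\Delta$, and with probability at most $p$ whenever the singular gap of $A$ is below $(1-\varepsilon)\Delta$. \emph{Claim.} For every $p<\frac12$ there is a constant $c>0$, depending only on $p$, such that for all $N\ge2$, $d\ge2$, all unit vectors $|x_1\rangle,|x_2\rangle\in\mathbb C^d$, all $s\ge1$ and all $\Delta>0$, $0\le\varepsilon<1$ with $(1+\varepsilon)\Delta<1$, every algorithm that decides the singular gap with error probability at most $p$ on $\mathcal D_N$, or that does so on $\mathcal T_N$, makes at least $c\sqrt N$ uses of the block encoding. -/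

import Mathlib

namespace GapQuery

/-- The singular values of a real `N × N` matrix, in decreasing order and with multiplicity,
indexed from `0` (so `singularValue A 0` is the largest one). -/
noncomputable def singularValue {N : ℕ} (A : Matrix (Fin N) (Fin N) ℝ) (k : ℕ) : ℝ :=
  LinearMap.singularValues (Matrix.toEuclideanLin A) k

/-- The singular gap: the difference of the two largest singular values. -/
noncomputable def singularGap {N : ℕ} (A : Matrix (Fin N) (Fin N) ℝ) : ℝ :=
  singularValue A 0 - singularValue A 1

/-- Transition matrices of ergodic Markov chains on `N` states: row-stochastic, and every state is
reachable from every state with positive probability in finitely many steps. -/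
def IsErgodicChain {N : ℕ} (P : Matrix (Fin N) (Fin N) ℝ) : Prop :=
  P ∈ Matrix.rowStochastic ℝ (Fin N) ∧ P.IsIrreducible

/-- The symmetrised discriminant `D i j = √(P i j * P j i)`. -/
noncomputable def symmDiscriminant {N : ℕ} (P : Matrix (Fin N) (Fin N) ℝ) :
    Matrix (Fin N) (Fin N) ℝ :=
  Matrix.of fun i j => √(P i j * P j i)

/-- Symmetrised discriminants of ergodic chains, with largest singular value equal to one. -/
def discriminantInputs (N : ℕ) : Set (Matrix (Fin N) (Fin N) ℝ) :=
  {A | (∃ P, IsErgodicChain P ∧ A = symmDiscriminant P) ∧ singularValue A 0 = 1}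

/-- Transition matrices of ergodic chains, with largest singular value equal to one
(equivalently, the doubly-stochastic ones). -/
def transitionInputs (N : ℕ) : Set (Matrix (Fin N) (Fin N) ℝ) :=
  {A | IsErgodicChain A ∧ singularValue A 0 = 1}

/-- Unit vectors, i.e. pure quantum states. -/
def IsState {ι : Type*} [Fintype ι] (ψ : ι → ℂ) : Prop :=
  ∑ i, ‖ψ i‖ ^ 2 = 1

/-- `U` is a block encoding of `A` with scaling `s` with respect to the states `x₁`, `x₂` of a
`d`-dimensional ancilla: `U` is unitary on `ℂ^d ⊗ ℂ^N` and
`(⟨x₁| ⊗ I) U (|x₂⟩ ⊗ I) = (1 / s) A`. -/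
def IsBlockEncoding {d N : ℕ} (x₁ x₂ : Fin d → ℂ) (s : ℝ)
    (U : Matrix (Fin d × Fin N) (Fin d × Fin N) ℂ) (A : Matrix (Fin N) (Fin N) ℝ) : Prop :=
  U ∈ Matrix.unitaryGroup (Fin d × Fin N) ℂ ∧
    ∀ i j, ∑ a, ∑ b, star (x₁ a) * U (a, i) (b, j) * x₂ b = ((1 / s * A i j : ℝ) : ℂ)

/-- What a use of the oracle `U` does on one branch of the computation. -/
inductive QueryMode
  | idle
  | forward
  | backward

/-- The operator applied in each mode: the identity, `U` or `U†`. -/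
def QueryMode.apply {Q : Type*} [DecidableEq Q] (U : Matrix Q Q ℂ) : QueryMode → Matrix Q Q ℂ
  | .idle => 1
  | .forward => U
  | .backward => U.conjTranspose

/-- A quantum algorithm that makes `uses` uses of an unknown unitary on `ℂ^Q`. Its state space is
`ℂ^Q ⊗ ℂ^w` with a workspace of any finite dimension `w`. It starts in a fixed state and alternates
uses of the oracle with unitary gates that do not depend on the oracle. A use applies `U`, `U†` or
the identity to the register `Q`, controlled on the basis states of the workspace; this comprises
the plain uses `U ⊗ I`, `U† ⊗ I` and the controlled ones. At the end the computational basis is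
measured and the algorithm accepts when the outcome lies in `accept`. -/
structure QueryAlgorithm (Q : Type) [Fintype Q] [DecidableEq Q] where
  w : ℕ
  uses : ℕ
  init : Q × Fin w → ℂ
  init_isState : IsState init
  /-- How the `t`-th use of the oracle is controlled by the workspace. -/
  mode : ℕ → Fin w → QueryMode
  /-- The unitary applied right after the `t`-th use of the oracle. -/
  gate : ℕ → Matrix (Q × Fin w) (Q × Fin w) ℂ
  gate_unitary : ∀ t, gate t ∈ Matrix.unitaryGroup (Q × Fin w) ℂ
  accept : Finset (Q × Fin w)

namespace QueryAlgorithm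

variable {Q : Type} [Fintype Q] [DecidableEq Q]

/-- The operator of the `t`-th use of the oracle: block diagonal in the workspace basis. -/
def queryOp (𝒜 : QueryAlgorithm Q) (U : Matrix Q Q ℂ) (t : ℕ) :
    Matrix (Q × Fin 𝒜.w) (Q × Fin 𝒜.w) ℂ :=
  Matrix.blockDiagonal fun k => (𝒜.mode t k).apply U

/-- The state after `t` uses of the oracle `U`. -/
def stateAfter (𝒜 : QueryAlgorithm Q) (U : Matrix Q Q ℂ) : ℕ → Q × Fin 𝒜.w → ℂ
  | 0 => 𝒜.init
  | t + 1 => Matrix.mulVec (𝒜.gate t) (Matrix.mulVec (𝒜.queryOp U t) (stateAfter 𝒜 U t))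

/-- The probability (Born rule) that the algorithm accepts when run with the oracle `U`. -/
noncomputable def acceptProb (𝒜 : QueryAlgorithm Q) (U : Matrix Q Q ℂ) : ℝ :=
  ∑ b ∈ 𝒜.accept, ‖𝒜.stateAfter U 𝒜.uses b‖ ^ 2

end QueryAlgorithm

/-- With error probability at most `p`, the algorithm decides, for every matrix `A` in `inputs` and
from every block encoding of `A` (of the form fixed by `x₁`, `x₂`, `s`), whether the singular gap
of `A` is greater or less than `Δ`, where nothing is asked of it if the gap is within relative
error `ε` of `Δ`. Accepting means the answer `greater`. -/
def DecidesGap {d N : ℕ} (inputs : Set (Matrix (Fin N) (Fin N) ℝ)) (x₁ x₂ : Fin d → ℂ)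
    (s Δ ε p : ℝ) (𝒜 : QueryAlgorithm (Fin d × Fin N)) : Prop :=
  ∀ A ∈ inputs, ∀ U, IsBlockEncoding x₁ x₂ s U A →
    ((1 + ε) * Δ < singularGap A → 1 - p ≤ 𝒜.acceptProb U) ∧
    (singularGap A < (1 - ε) * Δ → 𝒜.acceptProb U ≤ p)

end GapQuery

/-!
The uniform chain `P = J / N` (`meanProj`) has singular values `1, 0, …, 0`, so its gap is `1`.
For a state `k`, let `Q k` (`markProj`) be the projection onto the component `e k - 1 / N` of the
basis vector `e k` orthogonal to the constants. For `0 ≤ μ < 1` the matrix `P + μ Q k`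
(`spikedChain`) has positive entries and is symmetric and doubly stochastic, hence it is an ergodic
chain that equals its own discriminant; its singular values are `1, μ, 0, …, 0`. With `μ` close
to `1` the gap lies below any given threshold, so one family of chains serves both input sets.

These chains are as hard to tell apart as the instances of unstructured search. Let `W r` be a
unitary of the ancilla with `⟨x₁| W r |x₂⟩ = r` (`exists_unitary_matrixElement`; this is where
`d ≥ 2` is needed). Then `W (1/s) ⊗ P + W (μ/s) ⊗ Q k + W 0 ⊗ (1 - P - Q k)` is a block encoding of
`P + μ Q k` (`isBlockEncoding_controlledUnitary`), and it differs from the encoding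
`W (1/s) ⊗ P + W 0 ⊗ (1 - P)` of `P` by `(W (μ/s) - W 0) ⊗ Q k`, which sees only the line of `Q k`
(`QueryMode.apply_controlledUnitary_sub`).

The hybrid argument (`QueryAlgorithm.ampNorm_stateAfter_sub_le`) then bounds the distance of the
final states by `2 ∑ t, ‖Q k ψ t‖`, where `ψ t` is the run on the uniform chain. As the lines of the
`Q k` form a tight frame, `∑ k, Q k = N / (N - 1) (1 - P)`, the sum of `‖Q k ψ t‖²` over `k` is at
most `2` (`sum_ampNorm_sq_systemOp_markProj_le`). An algorithm that distinguishes every `k` with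
bias `1 - 2 p` therefore has `(1 - 2 p)² N ≤ 32 T²`.
-/

namespace GapQuery

open Matrix Kronecker

/-! ### The uniform chain and its spiked perturbations -/

/-- The orthogonal projection onto the constant vectors; as a Markov chain, the one that jumps to
a uniformly random state. -/
noncomputable def meanProj (N : ℕ) : Matrix (Fin N) (Fin N) ℝ :=
  Matrix.of fun _ _ => (N : ℝ)⁻¹

/-- The component of the basis vector `e k` orthogonal to the constant vectors. -/
noncomputable def devVec {N : ℕ} (k : Fin N) (i : Fin N) : ℝ :=
  (if i = k then 1 else 0) - (N : ℝ)⁻¹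

/-- The orthogonal projection onto the line spanned by `devVec k`. -/
noncomputable def markProj {N : ℕ} (k : Fin N) : Matrix (Fin N) (Fin N) ℝ :=
  ((N : ℝ) / (N - 1)) • vecMulVec (devVec k) (devVec k)

/-- The uniform chain with a second eigenvalue `μ` planted at the state `k`. For `μ` close to `1`
the state `k` is nearly isolated. -/
noncomputable def spikedChain {N : ℕ} (k : Fin N) (μ : ℝ) : Matrix (Fin N) (Fin N) ℝ :=
  meanProj N + μ • markProj k

variable {N : ℕ}

lemma meanProj_mulVec (x : Fin N → ℝ) (i : Fin N) :
    (meanProj N *ᵥ x) i = (N : ℝ)⁻¹ * ∑ j, x j := by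
  simp [meanProj, mulVec, dotProduct, Finset.mul_sum]

lemma natCast_ne_zero_of_two_le (hN : 2 ≤ N) : (N : ℝ) ≠ 0 := by
  have : (2 : ℝ) ≤ N := by exact_mod_cast hN
  positivity

lemma natCast_sub_one_pos (hN : 2 ≤ N) : (0 : ℝ) < N - 1 := by
  have : (2 : ℝ) ≤ N := by exact_mod_cast hN
  linarith

lemma sum_devVec (hN : 2 ≤ N) (k : Fin N) : ∑ i, devVec k i = 0 := by
  have := natCast_ne_zero_of_two_le hN
  simp [devVec, this]

lemma devVec_dotProduct_self (hN : 2 ≤ N) (k : Fin N) :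
    devVec k ⬝ᵥ devVec k = ((N : ℝ) - 1) / N := by
  have h0 := natCast_ne_zero_of_two_le hN
  have h : devVec k ⬝ᵥ devVec k = devVec k k - (N : ℝ)⁻¹ * ∑ i, devVec k i := by
    rw [dotProduct, Finset.mul_sum]
    conv_lhs => enter [2, i]; rw [show devVec k i * devVec k i
      = (if i = k then devVec k i else 0) - (N : ℝ)⁻¹ * devVec k i by
        conv_lhs => enter [1]; rw [devVec]
        split_ifs <;> ring]
    rw [Finset.sum_sub_distrib, Finset.sum_ite_eq' Finset.univ k]
    simp
  rw [h, sum_devVec hN]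
  simp only [devVec, if_true]
  field_simp
  ring

lemma meanProj_mulVec_devVec (hN : 2 ≤ N) (k : Fin N) : meanProj N *ᵥ devVec k = 0 := by
  ext i
  rw [meanProj_mulVec, sum_devVec hN]
  simp

lemma meanProj_mulVec_one (hN : 2 ≤ N) : meanProj N *ᵥ 1 = 1 := by
  ext i
  rw [meanProj_mulVec]
  simp [natCast_ne_zero_of_two_le hN]

lemma transpose_meanProj : (meanProj N)ᵀ = meanProj N := rfl

lemma transpose_markProj (k : Fin N) : (markProj k)ᵀ = markProj k := by
  simp [markProj, transpose_smul, transpose_vecMulVec]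

lemma isStarProjection_meanProj (hN : 2 ≤ N) : IsStarProjection (meanProj N) := by
  refine isStarProjection_iff'.2 ⟨?_, ?_⟩
  · ext i j
    simp [meanProj, mul_apply, natCast_ne_zero_of_two_le hN]
  · ext i j
    simp [meanProj, star_apply]

lemma isStarProjection_markProj (hN : 2 ≤ N) (k : Fin N) : IsStarProjection (markProj k) := by
  have h0 := natCast_ne_zero_of_two_le hN
  have h1 := (natCast_sub_one_pos hN).ne'
  refine isStarProjection_iff'.2 ⟨?_, ?_⟩
  · rw [markProj, smul_mul_smul_comm, vecMulVec_mul_vecMulVec, devVec_dotProduct_self hN,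
      vecMulVec_smul, smul_smul]
    congr 1
    field_simp
  · rw [star_eq_conjTranspose, conjTranspose_eq_transpose_of_trivial, transpose_markProj]

lemma meanProj_mul_markProj (hN : 2 ≤ N) (k : Fin N) : meanProj N * markProj k = 0 := by
  rw [markProj, mul_smul_comm, mul_vecMulVec, meanProj_mulVec_devVec hN]
  simp

lemma markProj_mul_meanProj (hN : 2 ≤ N) (k : Fin N) : markProj k * meanProj N = 0 := by
  simpa [transpose_meanProj, transpose_markProj] using
    congrArg transpose (meanProj_mul_markProj hN k)

/-- The vectors `devVec k` form a tight frame of the complement of the constant vectors. -/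
lemma sum_markProj (hN : 2 ≤ N) :
    ∑ k : Fin N, markProj k = ((N : ℝ) / (N - 1)) • (1 - meanProj N) := by
  have h0 := natCast_ne_zero_of_two_le hN
  simp only [markProj, ← Finset.smul_sum]
  congr 1
  ext i j
  have hsymm : ∀ k i : Fin N, devVec k i = devVec i k := fun k i => by
    simp only [devVec, eq_comm]
  simp only [Matrix.sum_apply, vecMulVec_apply, Matrix.sub_apply, meanProj, of_apply]
  have h : ∀ k, devVec k i * devVec k j
      = (if k = i then devVec k j else 0) - (N : ℝ)⁻¹ * devVec j k := fun k => by
    rw [hsymm k j, hsymm k i]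
    conv_lhs => enter [1]; rw [devVec]
    split_ifs <;> ring
  rw [Finset.sum_congr rfl fun k _ => h k, Finset.sum_sub_distrib, ← Finset.mul_sum,
    sum_devVec hN, Finset.sum_ite_eq' Finset.univ i]
  simp [devVec, one_apply, eq_comm]

lemma spikedChain_zero (k : Fin N) : spikedChain k 0 = meanProj N := by
  simp [spikedChain]

lemma transpose_spikedChain (k : Fin N) (μ : ℝ) : (spikedChain k μ)ᵀ = spikedChain k μ := by
  simp [spikedChain, transpose_meanProj, transpose_markProj]

lemma spikedChain_mulVec_one (hN : 2 ≤ N) (k : Fin N) (μ : ℝ) : spikedChain k μ *ᵥ 1 = 1 := by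
  have h := congrArg (· *ᵥ (1 : Fin N → ℝ)) (markProj_mul_meanProj hN k)
  simp only [← mulVec_mulVec, meanProj_mulVec_one hN] at h
  rw [spikedChain, add_mulVec, smul_mulVec, h, meanProj_mulVec_one hN]
  simp

lemma spikedChain_mulVec_devVec (hN : 2 ≤ N) (k : Fin N) (μ : ℝ) :
    spikedChain k μ *ᵥ devVec k = μ • devVec k := by
  have h0 := natCast_ne_zero_of_two_le hN
  have h1 := (natCast_sub_one_pos hN).ne'
  have h : markProj k *ᵥ devVec k = devVec k := by
    rw [markProj, smul_mulVec, vecMulVec_mulVec, devVec_dotProduct_self hN]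
    ext i
    simp
    field_simp
  rw [spikedChain, add_mulVec, smul_mulVec, h, meanProj_mulVec_devVec hN, zero_add]

lemma spikedChain_pos (hN : 2 ≤ N) (k : Fin N) {μ : ℝ} (h0 : 0 ≤ μ) (h1 : μ < 1) (i j : Fin N) :
    0 < spikedChain k μ i j := by
  have hN1 := natCast_sub_one_pos hN
  have hN0 : (0 : ℝ) < N := by linarith
  have hval : ∀ a b : ℝ, (N : ℝ)⁻¹ + μ * ((N : ℝ) / (N - 1) * ((a - (N : ℝ)⁻¹) * (b - (N : ℝ)⁻¹)))
      = ((N - 1) + μ * ((N * a - 1) * (N * b - 1))) / (N * (N - 1)) := fun a b => by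
    field_simp
  simp only [spikedChain, meanProj, markProj, Matrix.add_apply, of_apply, Matrix.smul_apply,
    vecMulVec_apply, devVec, smul_eq_mul, hval]
  refine div_pos ?_ (by positivity)
  split_ifs
  · nlinarith [mul_nonneg h0 (mul_pos hN1 hN1).le]
  · nlinarith
  · nlinarith
  · nlinarith

lemma isErgodicChain_spikedChain (hN : 2 ≤ N) (k : Fin N) {μ : ℝ} (h0 : 0 ≤ μ) (h1 : μ < 1) :
    IsErgodicChain (spikedChain k μ) := by
  have hpos := spikedChain_pos hN k h0 h1
  exact ⟨⟨fun i j => (hpos i j).le, spikedChain_mulVec_one hN k μ⟩,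
    IsPrimitive.isIrreducible ⟨fun i j => (hpos i j).le, 1, one_pos, by simpa using hpos⟩⟩

/-- Symmetric nonnegative matrices are their own discriminants. -/
lemma symmDiscriminant_eq_self {A : Matrix (Fin N) (Fin N) ℝ} (hA : Aᵀ = A)
    (h0 : ∀ i j, 0 ≤ A i j) : symmDiscriminant A = A := by
  ext i j
  have : A j i = A i j := congrFun₂ hA i j
  simp [symmDiscriminant, this, Real.sqrt_mul_self (h0 i j)]

/-! ### Singular values of the chains -/

lemma adjoint_comp_self_toEuclideanLin (A : Matrix (Fin N) (Fin N) ℝ) (hA : Aᵀ = A)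
    (x : EuclideanSpace ℝ (Fin N)) :
    (LinearMap.adjoint (toEuclideanLin A) ∘ₗ toEuclideanLin A) x
      = WithLp.toLp 2 ((A * A) *ᵥ WithLp.ofLp x) := by
  rw [← toEuclideanLin_conjTranspose_eq_adjoint, conjTranspose_eq_transpose_of_trivial, hA,
    ← mulVec_mulVec]
  rfl

lemma exists_singularValue_eq {A : Matrix (Fin N) (Fin N) ℝ} (hA : Aᵀ = A) {v : Fin N → ℝ}
    (hv : v ≠ 0) {μ : ℝ} (h0 : 0 ≤ μ) (h : A *ᵥ v = μ • v) :
    ∃ i : Fin N, singularValue A i = μ := by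
  have hn : Module.finrank ℝ (EuclideanSpace ℝ (Fin N)) = N := by simp
  have hev : Module.End.HasEigenvalue
      (LinearMap.adjoint (toEuclideanLin A) ∘ₗ toEuclideanLin A) (μ ^ 2) := by
    refine Module.End.hasEigenvalue_of_hasEigenvector (x := WithLp.toLp 2 v)
      (Module.End.hasEigenvector_iff.2 ⟨?_, by simpa using hv⟩)
    rw [Module.End.mem_eigenspace_iff, adjoint_comp_self_toEuclideanLin A hA, ← mulVec_mulVec]
    simp only [h, mulVec_smul, smul_smul, sq]
    rfl
  obtain ⟨i, hi⟩ := (toEuclideanLin A).isSymmetric_adjoint_comp_self.exists_eigenvalues_eq hn hev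
  refine ⟨i, ?_⟩
  rw [singularValue, LinearMap.singularValues_fin _ hn]
  have hi' : (toEuclideanLin A).isSymmetric_adjoint_comp_self.eigenvalues hn i = μ ^ 2 := hi
  rw [hi', Real.sqrt_sq h0]

lemma singularValue_antitone (A : Matrix (Fin N) (Fin N) ℝ) : Antitone (singularValue A) :=
  (toEuclideanLin A).singularValues_antitone

lemma singularValue_spikedChain_zero (hN : 2 ≤ N) (k : Fin N) {μ : ℝ} (h0 : 0 ≤ μ) (h1 : μ < 1) :
    singularValue (spikedChain k μ) 0 = 1 := by
  have hA := transpose_spikedChain k μ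
  have : NeZero N := ⟨by omega⟩
  apply le_antisymm
  · by_contra! hlt
    set σ := singularValue (spikedChain k μ) 0 with hσ
    obtain ⟨x, hx⟩ := (LinearMap.hasEigenvalue_adjoint_comp_self_sq_singularValues
      (toEuclideanLin (spikedChain k μ)) (n := 0) (by simp; omega)).exists_hasEigenvector
    have hx1 := congrArg WithLp.ofLp hx.apply_eq_smul
    rw [adjoint_comp_self_toEuclideanLin _ hA] at hx1
    change _ = σ ^ 2 • WithLp.ofLp x at hx1
    have hP := (isStarProjection_meanProj hN).isIdempotentElem.eq
    have hQ := (isStarProjection_markProj hN k).isIdempotentElem.eq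
    have hPQ := meanProj_mul_markProj hN k
    have hQP := markProj_mul_meanProj hN k
    have hsq : spikedChain k μ * spikedChain k μ = meanProj N + μ ^ 2 • markProj k := by
      simp [spikedChain, mul_add, add_mul, hP, hQ, hPQ, hQP, smul_smul, sq]
    rw [hsq] at hx1
    simp only at hx1
    -- Projecting the eigenvector equation onto either line kills that component of `x`,
    -- because the eigenvalue `σ ^ 2` exceeds both `1` and `μ ^ 2`.
    have hPx : meanProj N *ᵥ WithLp.ofLp x = 0 := by
      have h := congrArg (meanProj N *ᵥ ·) hx1
      simp only [mulVec_mulVec, mul_add, hP, mul_smul_comm, hPQ, smul_zero, add_zero,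
        mulVec_smul] at h
      have h2 : (σ ^ 2 - 1) • (meanProj N *ᵥ WithLp.ofLp x) = 0 := by
        rw [sub_smul, one_smul, ← h, sub_self]
      exact (smul_eq_zero.1 h2).resolve_left (by nlinarith)
    have hQx : markProj k *ᵥ WithLp.ofLp x = 0 := by
      have h := congrArg (markProj k *ᵥ ·) hx1
      simp only [mulVec_mulVec, mul_add, hQ, mul_smul_comm, hQP, zero_add, mulVec_smul,
        smul_mulVec] at h
      have h2 : (σ ^ 2 - μ ^ 2) • (markProj k *ᵥ WithLp.ofLp x) = 0 := by
        rw [sub_smul, ← h, sub_self]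
      exact (smul_eq_zero.1 h2).resolve_left (by nlinarith)
    rw [add_mulVec, smul_mulVec, hPx, hQx, smul_zero, add_zero] at hx1
    have hx0 := (smul_eq_zero.1 hx1.symm).resolve_left (by nlinarith)
    exact hx.2 (by ext i; exact congrFun hx0 i)
  · obtain ⟨i, hi⟩ := exists_singularValue_eq hA one_ne_zero zero_le_one
      (by rw [one_smul]; exact spikedChain_mulVec_one hN k μ)
    rw [← hi]
    exact singularValue_antitone _ (Nat.zero_le _)

/-- The planted eigenvalue is attained by some singular value other than the one at the constant
vectors, so the gap is at most `1 - μ`. -/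
lemma singularGap_spikedChain_le (hN : 2 ≤ N) (k : Fin N) {μ : ℝ} (h0 : 0 ≤ μ) (h1 : μ < 1) :
    singularGap (spikedChain k μ) ≤ 1 - μ := by
  have hA := transpose_spikedChain k μ
  have hσ := singularValue_spikedChain_zero hN k h0 h1
  have hv : devVec k ≠ 0 := fun h => by
    have := devVec_dotProduct_self hN k
    rw [h, zero_dotProduct, eq_comm, div_eq_zero_iff] at this
    exact this.elim (natCast_sub_one_pos hN).ne' (natCast_ne_zero_of_two_le hN)
  obtain ⟨i, hi⟩ := exists_singularValue_eq hA hv h0 (spikedChain_mulVec_devVec hN k μ)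
  have hi1 : 1 ≤ (i : ℕ) := by
    by_contra! h
    rw [Nat.lt_one_iff.1 h, hσ] at hi
    linarith
  have := singularValue_antitone (spikedChain k μ) hi1
  rw [singularGap, hσ]
  linarith

lemma singularGap_meanProj (hN : 2 ≤ N) : singularGap (meanProj N) = 1 := by
  have h0 : singularValue (meanProj N) 0 = 1 := by
    rw [← spikedChain_zero ⟨0, by omega⟩]
    exact singularValue_spikedChain_zero hN _ le_rfl one_pos
  have h1 : singularValue (meanProj N) 1 = 0 := by
    rw [singularValue, LinearMap.singularValues_eq_zero_iff_le_finrank_range]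
    have hle : LinearMap.range (toEuclideanLin (meanProj N))
        ≤ Submodule.span ℝ {WithLp.toLp 2 (1 : Fin N → ℝ)} := by
      rintro _ ⟨x, rfl⟩
      refine Submodule.mem_span_singleton.2 ⟨(N : ℝ)⁻¹ * ∑ j, x j, ?_⟩
      ext i
      simpa using (meanProj_mulVec (WithLp.ofLp x) i).symm
    have : Nonempty (Fin N) := ⟨⟨0, by omega⟩⟩
    exact (Submodule.finrank_mono hle).trans (finrank_span_singleton (by simp)).le
  rw [singularGap, h0, h1, sub_zero]

lemma spikedChain_mem_inputs (hN : 2 ≤ N) (k : Fin N) {μ : ℝ} (h0 : 0 ≤ μ) (h1 : μ < 1) :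
    spikedChain k μ ∈ discriminantInputs N ∧ spikedChain k μ ∈ transitionInputs N := by
  have hE := isErgodicChain_spikedChain hN k h0 h1
  have hσ := singularValue_spikedChain_zero hN k h0 h1
  exact ⟨⟨⟨_, hE, (symmDiscriminant_eq_self (transpose_spikedChain k μ)
    fun i j => (spikedChain_pos hN k h0 h1 i j).le).symm⟩, hσ⟩, hE, hσ⟩

/-! ### Block encodings -/

lemma isState_iff_norm_eq_one {ι : Type*} [Fintype ι] (x : ι → ℂ) :
    IsState x ↔ ‖WithLp.toLp 2 x‖ = 1 := by
  rw [IsState, ← sq_eq_sq₀ (norm_nonneg _) zero_le_one, one_pow, EuclideanSpace.norm_sq_eq]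

/-- In dimension at least two, every number in `[-1, 1]` is a matrix element of some unitary
between two given states. -/
lemma exists_unitary_matrixElement {d : ℕ} (hd : 2 ≤ d) {x₁ x₂ : Fin d → ℂ} (h₁ : IsState x₁)
    (h₂ : IsState x₂) {r : ℝ} (hr : r ^ 2 ≤ 1) :
    ∃ W ∈ unitaryGroup (Fin d) ℂ, ∑ a, ∑ b, star (x₁ a) * W a b * x₂ b = r := by
  rw [isState_iff_norm_eq_one] at h₁ h₂
  set v₁ := WithLp.toLp 2 x₁
  set v₂ := WithLp.toLp 2 x₂
  obtain ⟨z, hz, hz1⟩ : ∃ z : EuclideanSpace ℂ (Fin d), inner ℂ v₁ z = 0 ∧ ‖z‖ = 1 := by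
    have hne : (Submodule.span ℂ {v₁})ᗮ ≠ ⊥ := fun h => by
      have htop := (Submodule.orthogonal_eq_bot_iff (K := Submodule.span ℂ {v₁})).1 h
      have hf := finrank_span_singleton (K := ℂ) (v := v₁) (by
        intro h; simp [h] at h₁)
      rw [htop, finrank_top] at hf
      simp at hf
      omega
    obtain ⟨z, hz, hz0⟩ := Submodule.exists_mem_ne_zero_of_ne_bot hne
    rw [Submodule.mem_orthogonal_singleton_iff_inner_right] at hz
    refine ⟨((‖z‖⁻¹ : ℝ) : ℂ) • z, by rw [inner_smul_right, hz, mul_zero], ?_⟩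
    rw [norm_smul]
    simp [hz0]
  set y : EuclideanSpace ℂ (Fin d) := (r : ℂ) • v₁ + ((√(1 - r ^ 2) : ℝ) : ℂ) • z with hy
  have hv1y : inner ℂ v₁ y = r := by
    rw [hy, inner_add_right, inner_smul_right, inner_smul_right, hz, inner_self_eq_norm_sq_to_K, h₁]
    simp
  have hy1 : ‖y‖ = 1 := by
    rw [← sq_eq_sq₀ (norm_nonneg _) zero_le_one, hy, sq,
      norm_add_sq_eq_norm_sq_add_norm_sq_of_inner_eq_zero _ _
        (by rw [inner_smul_left, inner_smul_right, hz, mul_zero, mul_zero]),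
      norm_smul, norm_smul, h₁, hz1, Complex.norm_real, Complex.norm_real]
    have := Real.mul_self_sqrt (sub_nonneg.2 hr)
    simp only [mul_one, Real.norm_eq_abs, abs_mul_abs_self, this]
    ring
  -- Extend the isometry between lines `v₂ ↦ y` to the whole space.
  let L : Submodule.span ℂ {v₂} →ₗᵢ[ℂ] EuclideanSpace ℂ (Fin d) :=
    ((Submodule.span ℂ {y}).subtypeₗᵢ.comp
      (LinearIsometryEquiv.toSpanUnitSingleton y hy1).toLinearIsometry).comp
      (LinearIsometryEquiv.toSpanUnitSingleton v₂ h₂).symm.toLinearIsometry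
  have hLv : L ⟨v₂, Submodule.mem_span_singleton_self _⟩ = y := by
    have : (LinearIsometryEquiv.toSpanUnitSingleton (𝕜 := ℂ) v₂ h₂).symm
        ⟨v₂, Submodule.mem_span_singleton_self _⟩ = 1 := by
      rw [LinearIsometryEquiv.symm_apply_eq]
      simp
    simp [L, this]
  let f := L.extend.toLinearIsometryEquiv rfl
  have hf : f v₂ = y := by
    have := L.extend_apply ⟨v₂, Submodule.mem_span_singleton_self _⟩
    rw [hLv] at this
    exact this
  let b := EuclideanSpace.basisFun (Fin d) ℂ
  refine ⟨LinearMap.toMatrix b.toBasis b.toBasis f.toLinearEquiv.toLinearMap,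
    f.toMatrix_mem_unitaryGroup b b, ?_⟩
  set W := LinearMap.toMatrix b.toBasis b.toBasis f.toLinearEquiv.toLinearMap with hW
  have hWf : toEuclideanLin W v₂ = y := by
    rw [toEuclideanLin_eq_toLin_orthonormal, hW, Matrix.toLin_toMatrix]
    exact hf
  rw [← hv1y, ← hWf]
  simp only [PiLp.inner_apply, toLpLin_apply, mulVec, dotProduct, RCLike.inner_apply,
    Finset.sum_mul, v₁, v₂]
  refine Finset.sum_congr rfl fun a _ => Finset.sum_congr rfl fun b _ => ?_
  rw [starRingEnd_apply]
  ring

variable {d : ℕ}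

/-- The unitary that applies `Wa`, `Wb` or `Wc` to the ancilla according to the decomposition of
the system given by the projections `P`, `Q` and `1 - P - Q`. -/
noncomputable def controlledUnitary (Wa Wb Wc : Matrix (Fin d) (Fin d) ℂ)
    (P Q : Matrix (Fin N) (Fin N) ℝ) : Matrix (Fin d × Fin N) (Fin d × Fin N) ℂ :=
  Wa ⊗ₖ P.map (algebraMap ℝ ℂ) + Wb ⊗ₖ Q.map (algebraMap ℝ ℂ)
    + Wc ⊗ₖ (1 - P.map (algebraMap ℝ ℂ) - Q.map (algebraMap ℝ ℂ))

lemma isStarProjection_map_ofReal {P : Matrix (Fin N) (Fin N) ℝ} (hP : IsStarProjection P) :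
    P.map (algebraMap ℝ ℂ) * P.map (algebraMap ℝ ℂ) = P.map (algebraMap ℝ ℂ) ∧
      (P.map (algebraMap ℝ ℂ))ᴴ = P.map (algebraMap ℝ ℂ) := by
  constructor
  · rw [← Matrix.map_mul, hP.isIdempotentElem.eq]
  · have h : Pᴴ = P := hP.isSelfAdjoint
    ext i j
    have : P j i = P i j := by simpa using congrFun₂ h i j
    simp [this]

lemma map_ofReal_mul_eq_zero {P Q : Matrix (Fin N) (Fin N) ℝ} (h : P * Q = 0) :
    P.map (algebraMap ℝ ℂ) * Q.map (algebraMap ℝ ℂ) = 0 := by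
  rw [← Matrix.map_mul, h]
  ext i j
  simp

lemma controlledUnitary_mem_unitaryGroup {Wa Wb Wc : Matrix (Fin d) (Fin d) ℂ}
    (ha : Wa ∈ unitaryGroup (Fin d) ℂ) (hb : Wb ∈ unitaryGroup (Fin d) ℂ)
    (hc : Wc ∈ unitaryGroup (Fin d) ℂ) {P Q : Matrix (Fin N) (Fin N) ℝ}
    (hP : IsStarProjection P) (hQ : IsStarProjection Q) (hPQ : P * Q = 0) (hQP : Q * P = 0) :
    controlledUnitary Wa Wb Wc P Q ∈ unitaryGroup (Fin d × Fin N) ℂ := by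
  obtain ⟨hP2, hPs⟩ := isStarProjection_map_ofReal hP
  obtain ⟨hQ2, hQs⟩ := isStarProjection_map_ofReal hQ
  have hPQ' := map_ofReal_mul_eq_zero hPQ
  have hQP' := map_ofReal_mul_eq_zero hQP
  rw [mem_unitaryGroup_iff', star_eq_conjTranspose] at ha hb hc ⊢
  simp only [controlledUnitary, conjTranspose_add, conjTranspose_kronecker, conjTranspose_sub,
    conjTranspose_one, hPs, hQs, add_mul, mul_add, ← mul_kronecker_mul, ha, hb, hc, mul_sub,
    sub_mul, hP2, hQ2, hPQ', hQP', mul_one, one_mul, sub_zero, sub_self, kronecker_zero, add_zero,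
    zero_add, ← kronecker_add]
  rw [show P.map (algebraMap ℝ ℂ) + Q.map (algebraMap ℝ ℂ)
    + (1 - P.map (algebraMap ℝ ℂ) - Q.map (algebraMap ℝ ℂ)) = 1 by abel]
  exact one_kronecker_one

lemma isBlockEncoding_controlledUnitary {x₁ x₂ : Fin d → ℂ} {s μ : ℝ}
    {Wa Wb Wc : Matrix (Fin d) (Fin d) ℂ}
    (ha : Wa ∈ unitaryGroup (Fin d) ℂ) (hb : Wb ∈ unitaryGroup (Fin d) ℂ)
    (hc : Wc ∈ unitaryGroup (Fin d) ℂ)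
    (ha' : ∑ a, ∑ b, star (x₁ a) * Wa a b * x₂ b = (1 / s : ℝ))
    (hb' : ∑ a, ∑ b, star (x₁ a) * Wb a b * x₂ b = (μ / s : ℝ))
    (hc' : ∑ a, ∑ b, star (x₁ a) * Wc a b * x₂ b = (0 : ℝ)) {P Q : Matrix (Fin N) (Fin N) ℝ}
    (hP : IsStarProjection P) (hQ : IsStarProjection Q) (hPQ : P * Q = 0) (hQP : Q * P = 0) :
    IsBlockEncoding x₁ x₂ s (controlledUnitary Wa Wb Wc P Q) (P + μ • Q) := by
  refine ⟨controlledUnitary_mem_unitaryGroup ha hb hc hP hQ hPQ hQP, fun i j => ?_⟩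
  have hterm : ∀ a b, star (x₁ a) * controlledUnitary Wa Wb Wc P Q (a, i) (b, j) * x₂ b
      = star (x₁ a) * Wa a b * x₂ b * (P i j : ℂ) + star (x₁ a) * Wb a b * x₂ b * (Q i j : ℂ)
        + star (x₁ a) * Wc a b * x₂ b
          * (((1 : Matrix (Fin N) (Fin N) ℂ) i j - P i j) - Q i j) := fun a b => by
    simp only [controlledUnitary, Matrix.add_apply, Matrix.sub_apply, kronecker_apply, map_apply,
      Complex.coe_algebraMap]
    ring
  simp only [hterm, Finset.sum_add_distrib, ← Finset.sum_mul, ha', hb', hc', Matrix.add_apply,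
    Matrix.smul_apply, smul_eq_mul]
  push_cast
  ring

lemma QueryMode.apply_mem_unitaryGroup {Q : Type*} [Fintype Q] [DecidableEq Q] {U : Matrix Q Q ℂ}
    (hU : U ∈ unitaryGroup Q ℂ) (m : QueryMode) : m.apply U ∈ unitaryGroup Q ℂ := by
  cases m
  · exact one_mem _
  · exact hU
  · exact Unitary.star_mem hU

/-- Changing the unitary attached to the projection `Q` changes a use of the oracle only on the
range of `Q`. -/
lemma QueryMode.apply_controlledUnitary_sub (m : QueryMode) (Wa Wb Wc : Matrix (Fin d) (Fin d) ℂ)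
    (P : Matrix (Fin N) (Fin N) ℝ) {Q : Matrix (Fin N) (Fin N) ℝ} (hQ : IsStarProjection Q) :
    m.apply (controlledUnitary Wa Wb Wc P Q) - m.apply (controlledUnitary Wa Wc Wc P Q)
      = (m.apply (Wb ⊗ₖ (1 : Matrix (Fin N) (Fin N) ℂ)) - m.apply (Wc ⊗ₖ 1))
        * ((1 : Matrix (Fin d) (Fin d) ℂ) ⊗ₖ Q.map (algebraMap ℝ ℂ)) := by
  have hQs := (isStarProjection_map_ofReal hQ).2
  cases m
  · simp [QueryMode.apply]
  · simp only [QueryMode.apply, controlledUnitary, sub_mul, ← mul_kronecker_mul, mul_one, one_mul]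
    abel
  · simp only [QueryMode.apply, controlledUnitary, sub_mul, ← mul_kronecker_mul, mul_one, one_mul,
      conjTranspose_add, conjTranspose_kronecker, hQs, conjTranspose_one]
    abel

lemma controlledUnitary_self (Wa Wc : Matrix (Fin d) (Fin d) ℂ) (P Q : Matrix (Fin N) (Fin N) ℝ) :
    controlledUnitary Wa Wc Wc P Q = controlledUnitary Wa Wc Wc P 0 := by
  simp only [controlledUnitary, add_assoc, ← kronecker_add]
  congr 2
  ext i j
  simp

/-! ### Euclidean norms of state vectors -/

section Norm

variable {ι : Type*} [Fintype ι]

/-- The Euclidean norm of a vector of amplitudes. -/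
noncomputable def ampNorm (v : ι → ℂ) : ℝ := ‖WithLp.toLp 2 v‖

lemma ampNorm_nonneg (v : ι → ℂ) : 0 ≤ ampNorm v := norm_nonneg _

lemma ampNorm_sq (v : ι → ℂ) : ampNorm v ^ 2 = ∑ i, ‖v i‖ ^ 2 := by
  rw [ampNorm, EuclideanSpace.norm_sq_eq]

lemma ampNorm_add_le (v w : ι → ℂ) : ampNorm (v + w) ≤ ampNorm v + ampNorm w :=
  norm_add_le (WithLp.toLp 2 v) (WithLp.toLp 2 w)

lemma ampNorm_sub_le (v w : ι → ℂ) : ampNorm (v - w) ≤ ampNorm v + ampNorm w :=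
  norm_sub_le (WithLp.toLp 2 v) (WithLp.toLp 2 w)

lemma star_dotProduct_self (v : ι → ℂ) : star v ⬝ᵥ v = ((ampNorm v ^ 2 : ℝ) : ℂ) := by
  rw [ampNorm_sq, dotProduct, Complex.ofReal_sum]
  refine Finset.sum_congr rfl fun i _ => ?_
  rw [Pi.star_apply, RCLike.star_def, Complex.conj_mul', Complex.ofReal_pow]

lemma star_mulVec_dotProduct_mulVec (M : Matrix ι ι ℂ) (v : ι → ℂ) :
    star (M *ᵥ v) ⬝ᵥ (M *ᵥ v) = star v ⬝ᵥ ((Mᴴ * M) *ᵥ v) := by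
  rw [star_mulVec, dotProduct_mulVec, vecMul_vecMul, ← dotProduct_mulVec]

lemma ampNorm_sq_mulVec (M : Matrix ι ι ℂ) (v : ι → ℂ) :
    ampNorm (M *ᵥ v) ^ 2 = (star v ⬝ᵥ ((Mᴴ * M) *ᵥ v)).re := by
  rw [← star_mulVec_dotProduct_mulVec, star_dotProduct_self, Complex.ofReal_re]

/-- The outcome probabilities of two states differ by at most twice the distance of the states. -/
lemma sum_sq_sub_sum_sq_le {v w : ι → ℂ} (hv : ampNorm v = 1) (hw : ampNorm w = 1)
    (s : Finset ι) : ∑ i ∈ s, ‖v i‖ ^ 2 - ∑ i ∈ s, ‖w i‖ ^ 2 ≤ 2 * ampNorm (v - w) := by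
  have hterm : ∀ i, ‖v i‖ ^ 2 - ‖w i‖ ^ 2 ≤ ‖v i - w i‖ * ‖v i‖ + ‖v i - w i‖ * ‖w i‖ := fun i => by
    have h1 := norm_sub_norm_le (v i) (w i)
    have h2 := norm_nonneg (v i)
    have h3 := norm_nonneg (w i)
    nlinarith
  have hCS : ∀ u : ι → ℂ, ampNorm u = 1 → ∑ i ∈ s, ‖v i - w i‖ * ‖u i‖ ≤ ampNorm (v - w) := by
    intro u hu
    calc ∑ i ∈ s, ‖v i - w i‖ * ‖u i‖ ≤ ∑ i, ‖v i - w i‖ * ‖u i‖ :=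
          Finset.sum_le_sum_of_subset_of_nonneg (Finset.subset_univ _)
            fun i _ _ => by positivity
      _ ≤ √(∑ i, ‖v i - w i‖ ^ 2) * √(∑ i, ‖u i‖ ^ 2) := Real.sum_mul_le_sqrt_mul_sqrt _ _ _
      _ = ampNorm (v - w) := by
          rw [← ampNorm_sq u, hu]
          have : ∑ i, ‖v i - w i‖ ^ 2 = ampNorm (v - w) ^ 2 := (ampNorm_sq (v - w)).symm
          rw [this, Real.sqrt_sq (ampNorm_nonneg _)]
          simp
  calc ∑ i ∈ s, ‖v i‖ ^ 2 - ∑ i ∈ s, ‖w i‖ ^ 2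
      ≤ ∑ i ∈ s, (‖v i - w i‖ * ‖v i‖ + ‖v i - w i‖ * ‖w i‖) := by
        rw [← Finset.sum_sub_distrib]
        exact Finset.sum_le_sum fun i _ => hterm i
    _ ≤ 2 * ampNorm (v - w) := by
        rw [Finset.sum_add_distrib]
        linarith [hCS v hv, hCS w hw]

lemma ampNorm_sq_mulVec_of_isStarProjection {E : Matrix ι ι ℂ} (hE : IsStarProjection E)
    (v : ι → ℂ) : ampNorm (E *ᵥ v) ^ 2 = (star v ⬝ᵥ (E *ᵥ v)).re := by
  have h : Eᴴ = E := hE.isSelfAdjoint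
  rw [ampNorm_sq_mulVec, h, hE.isIdempotentElem.eq]

variable [DecidableEq ι]

lemma ampNorm_mulVec_of_mem_unitaryGroup {U : Matrix ι ι ℂ} (hU : U ∈ unitaryGroup ι ℂ)
    (v : ι → ℂ) : ampNorm (U *ᵥ v) = ampNorm v := by
  rw [mem_unitaryGroup_iff', star_eq_conjTranspose] at hU
  rw [← sq_eq_sq₀ (ampNorm_nonneg _) (ampNorm_nonneg _), ampNorm_sq_mulVec, hU, one_mulVec,
    star_dotProduct_self, Complex.ofReal_re]

lemma re_star_dotProduct_one_sub_mulVec_le {E : Matrix ι ι ℂ} (hE : IsStarProjection E)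
    (v : ι → ℂ) : (star v ⬝ᵥ ((1 - E) *ᵥ v)).re ≤ ampNorm v ^ 2 := by
  rw [sub_mulVec, one_mulVec, dotProduct_sub, Complex.sub_re,
    ← ampNorm_sq_mulVec_of_isStarProjection hE, star_dotProduct_self, Complex.ofReal_re]
  linarith [sq_nonneg (ampNorm (E *ᵥ v))]

end Norm

/-! ### The hybrid argument -/

namespace QueryAlgorithm

variable {Q : Type} [Fintype Q] [DecidableEq Q] (𝒜 : QueryAlgorithm Q)

lemma queryOp_mem_unitaryGroup {U : Matrix Q Q ℂ} (hU : U ∈ unitaryGroup Q ℂ) (t : ℕ) :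
    𝒜.queryOp U t ∈ unitaryGroup (Q × Fin 𝒜.w) ℂ := by
  rw [mem_unitaryGroup_iff', star_eq_conjTranspose, queryOp, blockDiagonal_conjTranspose,
    ← blockDiagonal_mul, ← blockDiagonal_one]
  congr 1
  ext1 k
  exact mem_unitaryGroup_iff'.1 (QueryMode.apply_mem_unitaryGroup hU _)

lemma ampNorm_stateAfter {U : Matrix Q Q ℂ} (hU : U ∈ unitaryGroup Q ℂ) (t : ℕ) :
    ampNorm (𝒜.stateAfter U t) = 1 := by
  induction t with
  | zero => exact (isState_iff_norm_eq_one _).1 𝒜.init_isState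
  | succ t ih =>
    rw [stateAfter, ampNorm_mulVec_of_mem_unitaryGroup (𝒜.gate_unitary t),
      ampNorm_mulVec_of_mem_unitaryGroup (𝒜.queryOp_mem_unitaryGroup hU t), ih]

/-- Replacing the oracle in one use at a time: the final states with two oracles differ by at most
the sum of the changes that single uses make to the run with the second oracle. -/
lemma ampNorm_stateAfter_sub_le {U V : Matrix Q Q ℂ} (hU : U ∈ unitaryGroup Q ℂ) (T : ℕ) :
    ampNorm (𝒜.stateAfter U T - 𝒜.stateAfter V T)
      ≤ ∑ t ∈ Finset.range T, ampNorm ((𝒜.queryOp U t - 𝒜.queryOp V t) *ᵥ 𝒜.stateAfter V t) := by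
  induction T with
  | zero => simp [stateAfter, ampNorm]
  | succ T ih =>
    rw [Finset.sum_range_succ, stateAfter, stateAfter, ← mulVec_sub,
      ampNorm_mulVec_of_mem_unitaryGroup (𝒜.gate_unitary T)]
    have h : 𝒜.queryOp U T *ᵥ 𝒜.stateAfter U T - 𝒜.queryOp V T *ᵥ 𝒜.stateAfter V T
        = 𝒜.queryOp U T *ᵥ (𝒜.stateAfter U T - 𝒜.stateAfter V T)
          + (𝒜.queryOp U T - 𝒜.queryOp V T) *ᵥ 𝒜.stateAfter V T := by
      rw [mulVec_sub, sub_mulVec]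
      abel
    rw [h]
    refine (ampNorm_add_le _ _).trans (add_le_add ?_ le_rfl)
    rw [ampNorm_mulVec_of_mem_unitaryGroup (𝒜.queryOp_mem_unitaryGroup hU T)]
    exact ih

end QueryAlgorithm

/-- The operator `1 ⊗ M ⊗ 1` on ancilla, system and workspace, for an operator `M` on the
system. -/
noncomputable def systemOp (d N w : ℕ) : Matrix (Fin N) (Fin N) ℝ →⋆ₐ[ℝ]
    Matrix ((Fin d × Fin N) × Fin w) ((Fin d × Fin N) × Fin w) ℂ where
  toFun M := blockDiagonal fun _ => (1 : Matrix (Fin d) (Fin d) ℂ) ⊗ₖ M.map (algebraMap ℝ ℂ)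
  map_one' := by
    rw [Matrix.map_one _ (map_zero _) (map_one _), one_kronecker_one]
    exact blockDiagonal_one
  map_zero' := by
    rw [Matrix.map_zero _ (map_zero _), kronecker_zero]
    exact blockDiagonal_zero
  map_mul' A B := by
    rw [Matrix.map_mul, ← blockDiagonal_mul]
    simp only [← mul_kronecker_mul, one_mul]
  map_add' A B := by
    rw [Matrix.map_add _ (map_add _), kronecker_add]
    exact blockDiagonal_add _ _
  commutes' r := by
    ext ⟨⟨a, i⟩, k⟩ ⟨⟨b, j⟩, l⟩
    simp only [blockDiagonal_apply, kronecker_apply, map_apply, algebraMap_matrix_apply, one_apply,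
      Prod.mk.injEq]
    split_ifs <;> simp_all
  map_star' A := by
    ext ⟨⟨a, i⟩, k⟩ ⟨⟨b, j⟩, l⟩
    simp only [blockDiagonal_apply, kronecker_apply, map_apply, one_apply, star_apply]
    split_ifs <;> simp_all

/-- The tight frame identity bounds the total weight that a state puts on the marked directions. -/
lemma sum_ampNorm_sq_systemOp_markProj_le (hN : 2 ≤ N) {w : ℕ}
    (v : (Fin d × Fin N) × Fin w → ℂ) :
    ∑ k : Fin N, ampNorm (systemOp d N w (markProj k) *ᵥ v) ^ 2 ≤ 2 * ampNorm v ^ 2 := by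
  have hN2 : (2 : ℝ) ≤ N := by exact_mod_cast hN
  have hN1 := natCast_sub_one_pos hN
  have hc : (N : ℝ) / (N - 1) ≤ 2 := by
    rw [div_le_iff₀ hN1]
    linarith
  simp only [ampNorm_sq_mulVec_of_isStarProjection ((isStarProjection_markProj hN _).map _)]
  rw [← Complex.re_sum, ← dotProduct_sum, ← sum_mulVec, ← map_sum, sum_markProj hN, map_smul,
    map_sub, map_one, smul_mulVec, dotProduct_smul, Complex.smul_re, smul_eq_mul]
  have h1 := re_star_dotProduct_one_sub_mulVec_le
    ((isStarProjection_meanProj hN).map (systemOp d N w)) v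
  calc _ ≤ (N : ℝ) / (N - 1) * ampNorm v ^ 2 := mul_le_mul_of_nonneg_left h1 (by positivity)
    _ ≤ _ := mul_le_mul_of_nonneg_right hc (sq_nonneg _)

lemma QueryAlgorithm.ampNorm_queryOp_controlledUnitary_sub_le (𝒜 : QueryAlgorithm (Fin d × Fin N))
    {Wa Wb Wc : Matrix (Fin d) (Fin d) ℂ} (hb : Wb ∈ unitaryGroup (Fin d) ℂ)
    (hc : Wc ∈ unitaryGroup (Fin d) ℂ) (P : Matrix (Fin N) (Fin N) ℝ)
    {Q : Matrix (Fin N) (Fin N) ℝ} (hQ : IsStarProjection Q) (t : ℕ)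
    (v : (Fin d × Fin N) × Fin 𝒜.w → ℂ) :
    ampNorm ((𝒜.queryOp (controlledUnitary Wa Wb Wc P Q) t
      - 𝒜.queryOp (controlledUnitary Wa Wc Wc P Q) t) *ᵥ v)
      ≤ 2 * ampNorm (systemOp d N 𝒜.w Q *ᵥ v) := by
  have hfac : 𝒜.queryOp (controlledUnitary Wa Wb Wc P Q) t
      - 𝒜.queryOp (controlledUnitary Wa Wc Wc P Q) t
      = (𝒜.queryOp (Wb ⊗ₖ 1) t - 𝒜.queryOp (Wc ⊗ₖ 1) t) * systemOp d N 𝒜.w Q := by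
    change _ = (_ - _) * blockDiagonal fun _ => _
    simp only [queryOp]
    rw [← blockDiagonal_sub, ← blockDiagonal_sub, ← blockDiagonal_mul]
    congr 1
    ext1 k
    exact (𝒜.mode t k).apply_controlledUnitary_sub Wa Wb Wc P hQ
  have hu : ∀ W ∈ unitaryGroup (Fin d) ℂ,
      W ⊗ₖ (1 : Matrix (Fin N) (Fin N) ℂ) ∈ unitaryGroup (Fin d × Fin N) ℂ :=
    fun W hW => kronecker_mem_unitary hW (one_mem _)
  rw [hfac, ← mulVec_mulVec, sub_mulVec]
  refine (ampNorm_sub_le _ _).trans ?_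
  rw [ampNorm_mulVec_of_mem_unitaryGroup (𝒜.queryOp_mem_unitaryGroup (hu _ hb) t),
    ampNorm_mulVec_of_mem_unitaryGroup (𝒜.queryOp_mem_unitaryGroup (hu _ hc) t), two_mul]

/-- An algorithm that tells the encoding of the uniform chain from the encodings of all the spiked
chains with bias `δ` makes at least of the order of `δ * √N` uses of the oracle. -/
lemma QueryAlgorithm.sq_mul_card_le_of_distinguishes (𝒜 : QueryAlgorithm (Fin d × Fin N))
    (hN : 2 ≤ N) {Wa Wb Wc : Matrix (Fin d) (Fin d) ℂ} (ha : Wa ∈ unitaryGroup (Fin d) ℂ)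
    (hb : Wb ∈ unitaryGroup (Fin d) ℂ) (hc : Wc ∈ unitaryGroup (Fin d) ℂ) {δ : ℝ} (hδ : 0 ≤ δ)
    (h : ∀ k : Fin N, δ ≤ 𝒜.acceptProb (controlledUnitary Wa Wc Wc (meanProj N) 0)
      - 𝒜.acceptProb (controlledUnitary Wa Wb Wc (meanProj N) (markProj k))) :
    δ ^ 2 * N ≤ 32 * (𝒜.uses : ℝ) ^ 2 := by
  set V := controlledUnitary Wa Wc Wc (meanProj N) 0
  have hP := isStarProjection_meanProj hN
  have hV : V ∈ unitaryGroup (Fin d × Fin N) ℂ :=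
    controlledUnitary_mem_unitaryGroup ha hc hc hP (.zero _) (mul_zero _) (zero_mul _)
  let E := fun (k : Fin N) (t : ℕ) =>
    ampNorm (systemOp d N 𝒜.w (markProj k) *ᵥ 𝒜.stateAfter V t)
  have hk : ∀ k : Fin N, δ ^ 2 ≤ 16 * (𝒜.uses * ∑ t ∈ Finset.range 𝒜.uses, E k t ^ 2) := by
    intro k
    set U := controlledUnitary Wa Wb Wc (meanProj N) (markProj k)
    have hQ := isStarProjection_markProj hN k
    have hU : U ∈ unitaryGroup (Fin d × Fin N) ℂ :=
      controlledUnitary_mem_unitaryGroup ha hb hc hP hQ (meanProj_mul_markProj hN k)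
        (markProj_mul_meanProj hN k)
    have hdist : ampNorm (𝒜.stateAfter U 𝒜.uses - 𝒜.stateAfter V 𝒜.uses)
        ≤ 2 * ∑ t ∈ Finset.range 𝒜.uses, E k t := by
      rw [Finset.mul_sum]
      refine (𝒜.ampNorm_stateAfter_sub_le hU _).trans (Finset.sum_le_sum fun t _ => ?_)
      have hVk : V = controlledUnitary Wa Wc Wc (meanProj N) (markProj k) :=
        (controlledUnitary_self _ _ _ _).symm
      have := 𝒜.ampNorm_queryOp_controlledUnitary_sub_le (Wa := Wa) hb hc (meanProj N) hQ t
        (𝒜.stateAfter V t)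
      rwa [← hVk] at this
    have hacc := sum_sq_sub_sum_sq_le (𝒜.ampNorm_stateAfter hV 𝒜.uses)
      (𝒜.ampNorm_stateAfter hU 𝒜.uses) 𝒜.accept
    have hcomm : ampNorm (𝒜.stateAfter V 𝒜.uses - 𝒜.stateAfter U 𝒜.uses)
        = ampNorm (𝒜.stateAfter U 𝒜.uses - 𝒜.stateAfter V 𝒜.uses) :=
      norm_sub_rev (WithLp.toLp 2 _) (WithLp.toLp 2 _)
    rw [hcomm] at hacc
    have hδ4 : δ ≤ 4 * ∑ t ∈ Finset.range 𝒜.uses, E k t := by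
      have := (h k).trans hacc
      linarith
    have hCS := sq_sum_le_card_mul_sum_sq (s := Finset.range 𝒜.uses) (f := E k)
    rw [Finset.card_range] at hCS
    calc δ ^ 2 ≤ (4 * ∑ t ∈ Finset.range 𝒜.uses, E k t) ^ 2 := pow_le_pow_left₀ hδ hδ4 2
      _ = 16 * (∑ t ∈ Finset.range 𝒜.uses, E k t) ^ 2 := by ring
      _ ≤ _ := by linarith
  calc δ ^ 2 * N = ∑ _k : Fin N, δ ^ 2 := by simp [mul_comm]
    _ ≤ ∑ k : Fin N, 16 * (𝒜.uses * ∑ t ∈ Finset.range 𝒜.uses, E k t ^ 2) :=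
        Finset.sum_le_sum fun k _ => hk k
    _ = 16 * (𝒜.uses * ∑ t ∈ Finset.range 𝒜.uses, ∑ k : Fin N, E k t ^ 2) := by
        rw [← Finset.mul_sum, ← Finset.mul_sum, Finset.sum_comm]
    _ ≤ 16 * (𝒜.uses * ∑ t ∈ Finset.range 𝒜.uses, (2 : ℝ)) := by
        gcongr with t
        have := sum_ampNorm_sq_systemOp_markProj_le hN (𝒜.stateAfter V t)
        rwa [𝒜.ampNorm_stateAfter hV t, one_pow, mul_one] at this
    _ = 32 * (𝒜.uses : ℝ) ^ 2 := by
        rw [Finset.sum_const, Finset.card_range, nsmul_eq_mul]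
        ring

end GapQuery

theorem mainTheorem3 (p : ℝ) (hp : p < 1 / 2) :
    ∃ c : ℝ, 0 < c ∧
      ∀ (N d : ℕ), 2 ≤ N → 2 ≤ d →
      ∀ (x₁ x₂ : Fin d → ℂ), GapQuery.IsState x₁ → GapQuery.IsState x₂ →
      ∀ (s Δ ε : ℝ), 1 ≤ s → 0 < Δ → 0 ≤ ε → ε < 1 → (1 + ε) * Δ < 1 →
      ∀ 𝒜 : GapQuery.QueryAlgorithm (Fin d × Fin N),
        (GapQuery.DecidesGap (GapQuery.discriminantInputs N) x₁ x₂ s Δ ε p 𝒜 ∨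
          GapQuery.DecidesGap (GapQuery.transitionInputs N) x₁ x₂ s Δ ε p 𝒜) →
        c * √(N : ℝ) ≤ (𝒜.uses : ℝ) := by
  open GapQuery in
  -- `6` is an upper bound for the `√32` coming from the hybrid argument.
  refine ⟨(1 - 2 * p) / 6, by linarith, ?_⟩
  intro N d hN hd x₁ x₂ hx₁ hx₂ s Δ ε hs hΔ hε0 hε1 hεΔ 𝒜 hdec
  have hlow0 : 0 < (1 - ε) * Δ := mul_pos (by linarith) hΔ
  have hlow1 : (1 - ε) * Δ < 1 := by nlinarith
  -- The planted eigenvalue leaves a gap of half the lower threshold.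
  set μ : ℝ := 1 - (1 - ε) * Δ / 2 with hμ
  have hμ0 : 0 ≤ μ := by linarith
  have hμ1 : μ < 1 := by linarith
  have hs0 : 0 < s := by linarith
  have hsq : ∀ r : ℝ, 0 ≤ r → r ≤ 1 → (r / s) ^ 2 ≤ 1 := fun r h0 h1 =>
    pow_le_one₀ (by positivity) ((div_le_one hs0).2 (h1.trans hs))
  obtain ⟨Wa, ha, ha'⟩ := exists_unitary_matrixElement hd hx₁ hx₂ (hsq 1 zero_le_one le_rfl)
  obtain ⟨Wb, hb, hb'⟩ := exists_unitary_matrixElement hd hx₁ hx₂ (hsq μ hμ0 hμ1.le)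
  obtain ⟨Wc, hc, hc'⟩ := exists_unitary_matrixElement hd hx₁ hx₂ (r := 0) (by norm_num)
  have hP := isStarProjection_meanProj hN
  have hgap : ∀ k : Fin N, 1 - 2 * p ≤
      𝒜.acceptProb (controlledUnitary Wa Wc Wc (meanProj N) 0)
        - 𝒜.acceptProb (controlledUnitary Wa Wb Wc (meanProj N) (markProj k)) := by
    intro k
    have hencV : IsBlockEncoding x₁ x₂ s (controlledUnitary Wa Wc Wc (meanProj N) 0)
        (meanProj N) := by
      have := isBlockEncoding_controlledUnitary (s := s) (μ := 0) ha hc hc ha' (by simpa using hc')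
        hc' hP (.zero _) (mul_zero _) (zero_mul _)
      simpa using this
    have hencU : IsBlockEncoding x₁ x₂ s (controlledUnitary Wa Wb Wc (meanProj N) (markProj k))
        (spikedChain k μ) :=
      isBlockEncoding_controlledUnitary ha hb hc ha' hb' hc' hP (isStarProjection_markProj hN k)
        (meanProj_mul_markProj hN k) (markProj_mul_meanProj hN k)
    have hmemV := spikedChain_mem_inputs hN k le_rfl one_pos
    rw [spikedChain_zero] at hmemV
    have hmemU := spikedChain_mem_inputs hN k hμ0 hμ1
    have hgV : (1 + ε) * Δ < singularGap (meanProj N) := by rwa [singularGap_meanProj hN]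
    have hgU : singularGap (spikedChain k μ) < (1 - ε) * Δ :=
      (singularGap_spikedChain_le hN k hμ0 hμ1).trans_lt (by linarith)
    rcases hdec with h | h
    · linarith [(h _ hmemV.1 _ hencV).1 hgV, (h _ hmemU.1 _ hencU).2 hgU]
    · linarith [(h _ hmemV.2 _ hencV).1 hgV, (h _ hmemU.2 _ hencU).2 hgU]
  have hmain := 𝒜.sq_mul_card_le_of_distinguishes hN ha hb hc (by linarith) hgap
  refine le_of_sq_le_sq ?_ (Nat.cast_nonneg _)
  rw [mul_pow, Real.sq_sqrt (Nat.cast_nonneg _), div_pow]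
  nlinarith [sq_nonneg (𝒜.uses : ℝ)]
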